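/- For $g\in L^2(\mathbb R^d)$ and $m,n\in\mathbb Z^d$ put $g_{m,n}(x)=e^{2\pi i n\cdot x}g(x-m)$. A family $\{f_k\}$ in $L^2(\mathbb R^d)$ is a frame if there are constants $A>0$ and $B<\infty$ with $A\|f\|_2^2\le\sum_k|\langle f,f_k\rangle|^2\le B\|f\|_2^2$ for all $f\in L^2(\mathbb R^d)$; it is an exact frame if, in addition, it is no longer a frame after removal of any one of its elements. Let $\mathcal F$ be the unitary Fourier transform on $L^2(\mathbb R^d)$ given formally by $\mathcal F f(\xi)=\hat f(\xi)=\int_{\mathbb R^d} f(x)e^{2\pi i x\cdot\xi}\,dx$. For $v,w\in\mathbb R^d$ let $P_v$ and $M_w$ be the operators in $L^2(\mathbb R^d)$ defined by $$P_v f(x)=(v\cdot x)f(x),\qquad M_w f=\mathcal F^{-1}\bigl(P_w\hat f\,\bigr),$$ on the domains of those $f\in L^2(\mathbb R^d)$ for which $(v\cdot x)f(x)$, respectively $(w\cdot\xi)\hat f(\xi)$, belongs to $L^2(\mathbb R^d)$; set $\|P_vf\|_2=\infty$, respectively $\|M_wf\|_2=\infty$, if $f$ is not in the domain. Let $g\in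 L^2(\mathbb R^d)$ be such that $\{g_{m,n}:m,n\in\mathbb Z^d\}$ is an exact frame for $L^2(\mathbb R^d)$. If $v,w\in\mathbb R^d$ satisfy $v\cdot w\neq0$, then $$\|P_v g\|_2\,\|M_w g\|_2=\infty .$$ -/

import Mathlib

open MeasureTheory
open scoped FourierTransform ENNReal InnerProductSpace

noncomputable section

namespace BalianLow

/-- The Hilbert space `L²(ℝᵈ)` of complex valued functions, for Lebesgue measure. -/
abbrev L2 (d : ℕ) : Type :=
  Lp (α := EuclideanSpace ℝ (Fin d)) ℂ 2 (volume : Measure (EuclideanSpace ℝ (Fin d)))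

section Frames

variable {H : Type*} [NormedAddCommGroup H] [InnerProductSpace ℂ H] {ι : Type*}

/-- A family `e` is a frame for `H` if there are bounds `A > 0` and `B` such that
`A ‖f‖² ≤ ∑ₖ |⟨f, eₖ⟩|² ≤ B ‖f‖²` for all `f`, the series being convergent. -/
def IsFrame (e : ι → H) : Prop :=
  ∃ A B : ℝ, 0 < A ∧ ∀ f : H,
    Summable (fun k => ‖⟪e k, f⟫_ℂ‖ ^ 2) ∧
      A * ‖f‖ ^ 2 ≤ ∑' k, ‖⟪e k, f⟫_ℂ‖ ^ 2 ∧
      ∑' k, ‖⟪e k, f⟫_ℂ‖ ^ 2 ≤ B * ‖f‖ ^ 2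

/-- A frame is exact if it is no longer a frame after removal of any one of its elements. -/
def IsExactFrame (e : ι → H) : Prop :=
  IsFrame e ∧ ∀ k : ι, ¬ IsFrame (fun j : {j : ι // j ≠ k} => e j)

end Frames

section Gabor

variable {d : ℕ}

/-- An integer vector, seen in `ℝᵈ`. -/
def intVec (m : Fin d → ℤ) : EuclideanSpace ℝ (Fin d) :=
  WithLp.toLp 2 (fun i => (m i : ℝ))

/-- The function `x ↦ e^{2πi n·x} g(x - m)`. -/
def timeFreqShiftFun (g : EuclideanSpace ℝ (Fin d) → ℂ) (m n : EuclideanSpace ℝ (Fin d)) :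
    EuclideanSpace ℝ (Fin d) → ℂ :=
  fun x => Complex.exp (2 * Real.pi * Complex.I * (⟪n, x⟫_ℝ : ℝ)) * g (x - m)

theorem memLp_timeFreqShiftFun (g : L2 d) (m n : EuclideanSpace ℝ (Fin d)) :
    MemLp (timeFreqShiftFun g m n) 2 volume := by
  have h1 : MemLp (fun x => g (x - m)) 2 (volume : Measure (EuclideanSpace ℝ (Fin d))) :=
    (Lp.memLp g).comp_measurePreserving (measurePreserving_sub_right volume m)
  refine h1.of_le ?_ (Filter.Eventually.of_forall fun x => ?_)
  · refine AEStronglyMeasurable.mul (Continuous.aestronglyMeasurable ?_) h1.1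
    fun_prop
  · have : (2 * Real.pi * Complex.I * (⟪n, x⟫_ℝ : ℝ) : ℂ)
        = ((2 * Real.pi * ⟪n, x⟫_ℝ : ℝ) : ℂ) * Complex.I := by
      push_cast; ring
    rw [timeFreqShiftFun, norm_mul, this, Complex.norm_exp_ofReal_mul_I, one_mul]

/-- The element `g_{m,n}(x) = e^{2πi n·x} g(x - m)` of `L²(ℝᵈ)`. -/
def timeFreqShift (g : L2 d) (m n : EuclideanSpace ℝ (Fin d)) : L2 d :=
  (memLp_timeFreqShiftFun g m n).toLp

/-- The Gabor system `{g_{m,n} : m, n ∈ ℤᵈ}`. -/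
def gaborSystem (g : L2 d) : (Fin d → ℤ) × (Fin d → ℤ) → L2 d :=
  fun p => timeFreqShift g (intVec p.1) (intVec p.2)

end Gabor

section Operators

variable {d : ℕ}

/-- The unitary Fourier transform of `L²(ℝᵈ)` with kernel `e^{2πi x·ξ}` (positive sign), which is
the inverse of Mathlib's Fourier transform, whose kernel is `e^{-2πi x·ξ}`. -/
def fourierL2 (d : ℕ) : L2 d ≃ₗᵢ[ℂ] L2 d :=
  (Lp.fourierTransformₗᵢ (EuclideanSpace ℝ (Fin d)) ℂ).symm

/-- The function `x ↦ (v·x) f(x)`. -/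
def mulDot (v : EuclideanSpace ℝ (Fin d)) (f : EuclideanSpace ℝ (Fin d) → ℂ) :
    EuclideanSpace ℝ (Fin d) → ℂ :=
  fun x => ((⟪v, x⟫_ℝ : ℝ) : ℂ) * f x

theorem mulDot_add_ae (v : EuclideanSpace ℝ (Fin d)) (f g : L2 d) :
    mulDot v (f + g : L2 d) =ᵐ[volume] mulDot v f + mulDot v g := by
  filter_upwards [Lp.coeFn_add f g] with x hx
  simp only [mulDot, hx, Pi.add_apply]; ring

theorem mulDot_smul_ae (v : EuclideanSpace ℝ (Fin d)) (c : ℂ) (f : L2 d) :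
    mulDot v (c • f : L2 d) =ᵐ[volume] c • mulDot v f := by
  filter_upwards [Lp.coeFn_smul c f] with x hx
  simp only [mulDot, hx, Pi.smul_apply, smul_eq_mul]; ring

/-- The operator `P_v f(x) = (v·x) f(x)` in `L²(ℝᵈ)`, on the domain of all `f ∈ L²(ℝᵈ)` for which
`(v·x) f(x)` is again in `L²(ℝᵈ)`. -/
def opP (v : EuclideanSpace ℝ (Fin d)) : L2 d →ₗ.[ℂ] L2 d where
  domain :=
    { carrier := {f | MemLp (mulDot v f) 2 volume}
      add_mem' := fun {f g} hf hg =>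
        (memLp_congr_ae (mulDot_add_ae v f g)).2 (MemLp.add hf hg)
      zero_mem' := by
        refine (memLp_congr_ae (g := 0) (Filter.Eventually.of_forall fun x => ?_)).2 MemLp.zero
        simp [mulDot]
      smul_mem' := fun c f hf =>
        (memLp_congr_ae (mulDot_smul_ae v c f)).2 (MemLp.const_smul hf c) }
  toFun :=
    { toFun := fun f => MemLp.toLp (mulDot v f.1) f.2
      map_add' := fun f g => by
        rw [← MemLp.toLp_add f.2 g.2]
        exact MemLp.toLp_congr _ _ (mulDot_add_ae v f.1 g.1)
      map_smul' := fun c f => by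
        rw [RingHom.id_apply, ← MemLp.toLp_const_smul c f.2]
        exact MemLp.toLp_congr _ _ (mulDot_smul_ae v c f.1) }

/-- The operator `M_w f = 𝓕⁻¹(P_w 𝓕 f)` in `L²(ℝᵈ)`, on the domain of all `f ∈ L²(ℝᵈ)` such that
`𝓕 f` is in the domain of `P_w`. -/
def opM (w : EuclideanSpace ℝ (Fin d)) : L2 d →ₗ.[ℂ] L2 d where
  domain := (opP w).domain.comap (fourierL2 d).toLinearEquiv.toLinearMap
  toFun :=
    { toFun := fun f => (fourierL2 d).symm (opP w ⟨fourierL2 d f.1, f.2⟩)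
      map_add' := fun f g => by
        rw [← map_add, ← LinearPMap.map_add]
        congr 2
        exact Subtype.ext (map_add (fourierL2 d) f.1 g.1)
      map_smul' := fun c f => by
        rw [RingHom.id_apply, ← map_smul, ← LinearPMap.map_smul]
        congr 2
        exact Subtype.ext (map_smul (fourierL2 d) c f.1) }

open scoped Classical in
/-- The extended norm `‖T f‖₂ ∈ [0, ∞]` of an operator `T` in `L²(ℝᵈ)`: it is the norm of `T f` if
`f` is in the domain of `T`, and `∞` otherwise. -/
def extNorm (T : L2 d →ₗ.[ℂ] L2 d) (f : L2 d) : ℝ≥0∞ :=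
  if h : f ∈ T.domain then ‖T ⟨f, h⟩‖ₑ else ∞

end Operators

end BalianLow

end

/-! Battle's commutator argument, applied to the dual window. An exact frame is biorthogonal to its
canonical dual, which for a Gabor system is generated by one window `γ`, with `⟪g, γ⟫ = 1`. Suppose
`g` lies in both domains, and let `E`, `T` be the derivatives at 0 of the modulations along `v` and
the translations along `w`, that is, `2πi P_v` and `2πi M_w`.

If `γ` also lies in both domains, `⟪E g, T γ⟫ - ⟪T g, E γ⟫` has two values. The canonical
commutation relation makes it `-2πi (v·w) ⟪g, γ⟫ ≠ 0` (`inner_deriv_commutator`). Expanding in the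
biorthogonal systems and moving the derivatives across makes it 0 (`IsDualWindow.inner_deriv_comm`).

That `γ` inherits the regularity of `g` comes from comparing frame coefficients: shifting `γ` costs
at most a constant times shifting `g` (`IsDualWindow.norm_tfShift_sub_le`). Differentiability of `g`
thus gives a Lipschitz bound for `γ`, and Fatou's lemma turns it into domain membership. -/

noncomputable section

namespace BalianLow

/-! ### Frames, canonical duals and exactness -/

section Frames

variable {H : Type*} [NormedAddCommGroup H] [InnerProductSpace ℂ H] {ι : Type*}

/-- A Bessel family has a bounded analysis operator `f ↦ (⟨eₖ, f⟩)ₖ` into `ℓ²`. -/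
theorem exists_analysis {e : ι → H} {B : ℝ}
    (h : ∀ f, Summable (fun k => ‖⟪e k, f⟫_ℂ‖ ^ 2) ∧ ∑' k, ‖⟪e k, f⟫_ℂ‖ ^ 2 ≤ B * ‖f‖ ^ 2) :
    ∃ C : H →L[ℂ] lp (fun _ : ι => ℂ) 2, ∀ f k, C f k = ⟪e k, f⟫_ℂ := by
  have hmem : ∀ f, Memℓp (fun k => ⟪e k, f⟫_ℂ) 2 := fun f =>
    memℓp_gen (by simpa using (h f).1)
  let T : H →ₗ[ℂ] lp (fun _ : ι => ℂ) 2 :=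
    { toFun := fun f => ⟨fun k => ⟪e k, f⟫_ℂ, hmem f⟩
      map_add' := fun f g => by
        ext k
        exact inner_add_right _ _ _
      map_smul' := fun c f => by
        ext k
        exact inner_smul_right _ _ _ }
  refine ⟨T.mkContinuous (Real.sqrt B) fun f => ?_, fun f k => rfl⟩
  have h1 : ‖T f‖ ^ 2 ≤ B * ‖f‖ ^ 2 := by
    have := lp.norm_rpow_eq_tsum (p := 2) (by norm_num) (T f)
    simp only [ENNReal.toReal_ofNat, Real.rpow_ofNat] at this
    rw [this]
    exact (h f).2
  calc ‖T f‖ ≤ Real.sqrt (B * ‖f‖ ^ 2) := Real.le_sqrt_of_sq_le h1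
    _ = Real.sqrt B * ‖f‖ := by rw [Real.sqrt_mul' _ (by positivity), Real.sqrt_sq (norm_nonneg _)]

theorem analysis_norm_sq {e : ι → H} {C : H →L[ℂ] lp (fun _ : ι => ℂ) 2}
    (hC : ∀ f k, C f k = ⟪e k, f⟫_ℂ) (f : H) :
    HasSum (fun k => ‖⟪e k, f⟫_ℂ‖ ^ 2) (‖C f‖ ^ 2) := by
  have := lp.hasSum_norm (p := 2) (by norm_num) (C f)
  simpa [hC] using this

theorem analysis_inner {e : ι → H} {C : H →L[ℂ] lp (fun _ : ι => ℂ) 2}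
    (hC : ∀ f k, C f k = ⟪e k, f⟫_ℂ) (f h : H) :
    HasSum (fun k => ⟪f, e k⟫_ℂ * ⟪e k, h⟫_ℂ) ⟪C f, C h⟫_ℂ := by
  have := lp.hasSum_inner (𝕜 := ℂ) (C f) (C h)
  simpa [hC, mul_comm] using this

/-- The inverse `R` of the frame operator of a frame `e`: the family `R eₖ` is the canonical dual. -/
theorem IsFrame.exists_inverse_frameOperator [CompleteSpace H] {e : ι → H} (he : IsFrame e) :
    ∃ R : H →L[ℂ] H, (∀ f h, ⟪R f, h⟫_ℂ = ⟪f, R h⟫_ℂ) ∧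
      ∀ f h, HasSum (fun k => ⟪R f, e k⟫_ℂ * ⟪e k, h⟫_ℂ) ⟪f, h⟫_ℂ := by
  obtain ⟨A, B, hA, hAB⟩ := he
  obtain ⟨C, hC⟩ := exists_analysis fun f => ⟨(hAB f).1, (hAB f).2.2⟩
  have hS : ∀ f h, ⟪(C.adjoint ∘L C) f, h⟫_ℂ = ⟪C f, C h⟫_ℂ := fun f h => by
    simp [ContinuousLinearMap.adjoint_inner_left]
  -- The lower frame bound makes the frame operator coercive, hence invertible.
  have hu : IsUnit (C.adjoint ∘L C) := by
    refine ContinuousLinearMap.isUnit_of_forall_le_norm_inner_map _ (c := A.toNNReal)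
      (Real.toNNReal_pos.2 hA) fun f => ?_
    rw [hS, inner_self_eq_norm_sq_to_K]
    have := (hAB f).2.1
    rw [(analysis_norm_sq hC f).tsum_eq] at this
    rw [Real.coe_toNNReal A hA.le]
    simpa [mul_comm] using this
  obtain ⟨u, hu⟩ := hu
  let R : H →L[ℂ] H := ↑u⁻¹
  have hSR : ∀ f, (C.adjoint ∘L C) (R f) = f := fun f => by
    rw [← hu]
    exact congrArg (fun T : H →L[ℂ] H => T f) u.mul_inv
  have hRi : ∀ f h, ⟪C (R f), C h⟫_ℂ = ⟪f, h⟫_ℂ := fun f h => by rw [← hS, hSR]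
  refine ⟨R, fun f h => ?_, fun f h => ?_⟩
  · rw [← inner_conj_symm, ← hRi, inner_conj_symm, hRi]
  · rw [← hRi]
    exact analysis_inner hC _ _

theorem hasSum_subtype_ne {E : Type*} [AddCommGroup E] [TopologicalSpace E]
    [IsTopologicalAddGroup E] {f : ι → E} {a : E} (h : HasSum f a) (k : ι) :
    HasSum (fun j : {j : ι // j ≠ k} => f j) (a - f k) := by
  classical
  have h1 : HasSum (f ∘ ((↑) : ({k}ᶜ : Set ι) → ι)) (a - f k) := by
    rw [hasSum_subtype_iff_indicator]
    convert! h.sub (hasSum_ite_eq k (f k)) using 2 with j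
    by_cases hj : j = k <;> simp [hj]
  exact h1

/-- Removal of an element `eₖ` with `⟨eₖ, R eₖ⟩ ≠ 1` leaves a frame. -/
theorem IsFrame.of_inner_ne_one {e : ι → H} (he : IsFrame e) (k : ι) (x : H)
    (hx : ∀ h, HasSum (fun j => ⟪x, e j⟫_ℂ * ⟪e j, h⟫_ℂ) ⟪e k, h⟫_ℂ)
    (h1 : ⟪x, e k⟫_ℂ ≠ 1) : IsFrame (fun j : {j : ι // j ≠ k} => e j) := by
  obtain ⟨A, B, hA, hAB⟩ := he
  have hsub : ∀ f, HasSum (fun j : {j : ι // j ≠ k} => ‖⟪e j, f⟫_ℂ‖ ^ 2)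
      ((∑' j, ‖⟪e j, f⟫_ℂ‖ ^ 2) - ‖⟪e k, f⟫_ℂ‖ ^ 2) := fun f =>
    hasSum_subtype_ne (hAB f).1.hasSum k
  have hup : ∀ f, ∑' j : {j : ι // j ≠ k}, ‖⟪e j, f⟫_ℂ‖ ^ 2 ≤ B * ‖f‖ ^ 2 := fun f => by
    rw [(hsub f).tsum_eq]
    have := (hAB f).2.2
    have : 0 ≤ ‖⟪e k, f⟫_ℂ‖ ^ 2 := by positivity
    linarith
  obtain ⟨C, hC⟩ := exists_analysis (e := fun j : {j : ι // j ≠ k} => e j)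
    fun f => ⟨(hsub f).summable, hup f⟩
  have hδ : 0 < ‖1 - ⟪x, e k⟫_ℂ‖ := norm_pos_iff.2 (sub_ne_zero.2 (Ne.symm h1))
  set D : ℝ := (‖C x‖ / ‖1 - ⟪x, e k⟫_ℂ‖) ^ 2 with hD
  have hD0 : 0 ≤ D := by positivity
  -- Isolating the `k`-th term of the expansion recovers the removed coefficient from the remaining
  -- ones, as `1 - ⟪x, e k⟫` can be divided out.
  have hk : ∀ f, ‖⟪e k, f⟫_ℂ‖ ^ 2 ≤ D * ‖C f‖ ^ 2 := fun f => by
    have h2 := (hasSum_subtype_ne (hx f) k).unique (analysis_inner hC x f)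
    have h3 : (1 - ⟪x, e k⟫_ℂ) * ⟪e k, f⟫_ℂ = ⟪C x, C f⟫_ℂ := by rw [← h2]; ring
    have h4 : ‖1 - ⟪x, e k⟫_ℂ‖ * ‖⟪e k, f⟫_ℂ‖ ≤ ‖C x‖ * ‖C f‖ := by
      rw [← norm_mul, h3]
      exact norm_inner_le_norm _ _
    rw [hD, ← mul_pow]
    refine pow_le_pow_left₀ (norm_nonneg _) ?_ 2
    rw [div_mul_eq_mul_div, le_div_iff₀ hδ]
    linarith
  refine ⟨A / (1 + D), B, by positivity, fun f => ⟨(hsub f).summable, ?_, hup f⟩⟩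
  have h5 := (hsub f).unique (analysis_norm_sq hC f)
  have h6 := (hAB f).2.1
  rw [(analysis_norm_sq hC f).tsum_eq, div_mul_eq_mul_div, div_le_iff₀ (by positivity)]
  have := hk f
  linarith

/-- An exact frame is biorthogonal to its canonical dual. -/
theorem IsExactFrame.inner_dual {e : ι → H} (he : IsExactFrame e)
    {R : H →L[ℂ] H} (hR : ∀ f h, ⟪R f, h⟫_ℂ = ⟪f, R h⟫_ℂ)
    (hRe : ∀ f h, HasSum (fun k => ⟪R f, e k⟫_ℂ * ⟪e k, h⟫_ℂ) ⟪f, h⟫_ℂ) (k : ι) :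
    ⟪R (e k), e k⟫_ℂ = 1 ∧ ∀ j, j ≠ k → ⟪e j, R (e k)⟫_ℂ = 0 := by
  have h1 : ⟪R (e k), e k⟫_ℂ = 1 := by
    by_contra h
    exact he.2 k (he.1.of_inner_ne_one k (R (e k)) (hRe (e k)) h)
  refine ⟨h1, fun j hj => ?_⟩
  have h2 := hRe (e k) (R (e k))
  -- The squared moduli sum to `⟪e k, R (e k)⟫ = 1`, and the `k`-th one alone is already 1; so the
  -- others vanish.
  have h3 : HasSum (fun j => ‖⟪e j, R (e k)⟫_ℂ‖ ^ 2) 1 := by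
    rw [← hR, h1] at h2
    have := Complex.hasSum_re h2
    convert! this using 2 with i
    rw [← inner_conj_symm (𝕜 := ℂ) (R (e k)) (e i), ← Complex.normSq_eq_conj_mul_self,
      Complex.normSq_eq_norm_sq]
    exact (Complex.ofReal_re _).symm
  have h4 := hasSum_subtype_ne h3 k
  rw [← inner_conj_symm (𝕜 := ℂ), h1] at h4
  norm_num at h4
  have := (hasSum_zero_iff_of_nonneg fun _ => by positivity).1 h4
  have := congrFun this ⟨j, hj⟩
  simpa using this

end Frames

/-! ### Time-frequency shifts and the integer lattice -/

section TimeFrequency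

variable {d : ℕ}

theorem coeFn_timeFreqShift (f : L2 d) (a b : EuclideanSpace ℝ (Fin d)) :
    timeFreqShift f a b =ᵐ[volume] timeFreqShiftFun f a b :=
  MemLp.coeFn_toLp _

theorem timeFreqShiftFun_congr {f h : EuclideanSpace ℝ (Fin d) → ℂ} (hfh : f =ᵐ[volume] h)
    (a b : EuclideanSpace ℝ (Fin d)) :
    timeFreqShiftFun f a b =ᵐ[volume] timeFreqShiftFun h a b := by
  have := (measurePreserving_sub_right volume a).quasiMeasurePreserving.ae_eq_comp hfh
  filter_upwards [this] with x hx
  exact congrArg _ hx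

theorem norm_exp_two_pi_mul (s : ℝ) : ‖Complex.exp (2 * Real.pi * Complex.I * s)‖ = 1 := by
  rw [show (2 * Real.pi * Complex.I * s : ℂ) = ((2 * Real.pi * s : ℝ) : ℂ) * Complex.I by
    push_cast; ring, Complex.norm_exp_ofReal_mul_I]

/-- The time-frequency shift `f ↦ e^{2πi b·x} f(x - a)` as a linear isometry. -/
def tfShift (a b : EuclideanSpace ℝ (Fin d)) : L2 d →ₗᵢ[ℂ] L2 d where
  toFun f := timeFreqShift f a b
  map_add' f h := by
    refine Lp.ext ?_
    filter_upwards [coeFn_timeFreqShift (f + h) a b, coeFn_timeFreqShift f a b,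
      coeFn_timeFreqShift h a b, timeFreqShiftFun_congr (Lp.coeFn_add f h) a b,
      Lp.coeFn_add (timeFreqShift f a b) (timeFreqShift h a b)] with x h1 h2 h3 h4 h5
    rw [h1, h4, h5, Pi.add_apply, h2, h3]
    simp only [timeFreqShiftFun, Pi.add_apply]
    ring
  map_smul' c f := by
    refine Lp.ext ?_
    filter_upwards [coeFn_timeFreqShift (c • f) a b, coeFn_timeFreqShift f a b,
      timeFreqShiftFun_congr (Lp.coeFn_smul c f) a b,
      Lp.coeFn_smul c (timeFreqShift f a b)] with x h1 h2 h4 h5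
    rw [h1, h4, RingHom.id_apply, h5, Pi.smul_apply, h2]
    simp only [timeFreqShiftFun, Pi.smul_apply, smul_eq_mul]
    ring
  norm_map' f := by
    change ‖timeFreqShift f a b‖ = ‖f‖
    rw [Lp.norm_def, Lp.norm_def, eLpNorm_congr_ae (coeFn_timeFreqShift f a b),
      ← eLpNorm_comp_measurePreserving (Lp.aestronglyMeasurable f)
        (measurePreserving_sub_right volume a)]
    congr 1
    refine eLpNorm_congr_norm_ae (Filter.Eventually.of_forall fun x => ?_)
    rw [timeFreqShiftFun, norm_mul, norm_exp_two_pi_mul, one_mul]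
    rfl

theorem coeFn_tfShift (a b : EuclideanSpace ℝ (Fin d)) (f : L2 d) :
    tfShift a b f =ᵐ[volume] timeFreqShiftFun f a b :=
  coeFn_timeFreqShift f a b

theorem tfShift_zero (f : L2 d) : tfShift 0 0 f = f := by
  refine Lp.ext ?_
  filter_upwards [coeFn_tfShift 0 0 f] with x h
  rw [h]
  simp [timeFreqShiftFun]

theorem tfShift_tfShift (a b a' b' : EuclideanSpace ℝ (Fin d)) (f : L2 d) :
    tfShift a' b' (tfShift a b f)
      = Complex.exp (2 * Real.pi * Complex.I * (-⟪b, a'⟫_ℝ : ℝ)) • tfShift (a + a') (b + b') f := by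
  refine Lp.ext ?_
  filter_upwards [coeFn_tfShift a' b' (tfShift a b f),
    timeFreqShiftFun_congr (coeFn_tfShift a b f) a' b', coeFn_tfShift (a + a') (b + b') f,
    Lp.coeFn_smul (Complex.exp (2 * Real.pi * Complex.I * (-⟪b, a'⟫_ℝ : ℝ)))
      (tfShift (a + a') (b + b') f)] with x h1 h2 h3 h4
  rw [h1, h2, h4, Pi.smul_apply, h3]
  simp only [timeFreqShiftFun, smul_eq_mul, inner_sub_right, inner_add_left]
  rw [← mul_assoc, ← mul_assoc, ← Complex.exp_add, ← Complex.exp_add, sub_sub, add_comm a' a]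
  congr 2
  push_cast
  ring

theorem tfShift_surjective (a b : EuclideanSpace ℝ (Fin d)) :
    Function.Surjective (tfShift a b) := fun f => by
  refine ⟨Complex.exp (2 * Real.pi * Complex.I * (-⟪b, a⟫_ℝ : ℝ)) • tfShift (-a) (-b) f, ?_⟩
  rw [map_smul, tfShift_tfShift, smul_smul, ← Complex.exp_add]
  simp [tfShift_zero]

theorem tfShift_comm (a b a' b' : EuclideanSpace ℝ (Fin d)) (f : L2 d) :
    tfShift a' b' (tfShift a b f)
      = Complex.exp (2 * Real.pi * Complex.I * (⟪b', a⟫_ℝ - ⟪b, a'⟫_ℝ : ℝ)) •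
        tfShift a b (tfShift a' b' f) := by
  rw [tfShift_tfShift, tfShift_tfShift, smul_smul, ← Complex.exp_add, add_comm a', add_comm b']
  congr 2
  push_cast
  ring

/-- The time-frequency shift by a lattice point. -/
def latShift (p : (Fin d → ℤ) × (Fin d → ℤ)) : L2 d →ₗᵢ[ℂ] L2 d :=
  tfShift (intVec p.1) (intVec p.2)

theorem gaborSystem_eq (g : L2 d) (p : (Fin d → ℤ) × (Fin d → ℤ)) :
    gaborSystem g p = latShift p g := rfl

theorem latShift_zero (f : L2 d) : latShift 0 f = f := by
  have : intVec (0 : Fin d → ℤ) = 0 := by ext i; simp [intVec]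
  simp only [latShift, Prod.fst_zero, Prod.snd_zero, this, tfShift_zero]

theorem exp_inner_intVec (m n : Fin d → ℤ) :
    Complex.exp (2 * Real.pi * Complex.I * (-⟪intVec m, intVec n⟫_ℝ : ℝ)) = 1 := by
  rw [Complex.exp_eq_one_iff]
  refine ⟨-∑ i, n i * m i, ?_⟩
  simp only [intVec, PiLp.inner_apply, RCLike.inner_apply, conj_trivial]
  push_cast
  ring

/-- The Heisenberg phase is trivial at integer points, so the lattice shifts form a commutative
group. -/
theorem latShift_latShift (p q : (Fin d → ℤ) × (Fin d → ℤ)) (f : L2 d) :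
    latShift q (latShift p f) = latShift (p + q) f := by
  have : ∀ m n : Fin d → ℤ, intVec m + intVec n = intVec (m + n) := fun m n => by
    ext i; simp [intVec]
  simp only [latShift, tfShift_tfShift, exp_inner_intVec, one_smul, this, Prod.fst_add,
    Prod.snd_add]

theorem inner_latShift_left (p : (Fin d → ℤ) × (Fin d → ℤ)) (f h : L2 d) :
    ⟪latShift p f, h⟫_ℂ = ⟪f, latShift (-p) h⟫_ℂ := by
  rw [← (latShift (-p)).inner_map_map, latShift_latShift, add_neg_cancel, latShift_zero]

theorem exists_latShift_tfShift (p : (Fin d → ℤ) × (Fin d → ℤ)) (a b : EuclideanSpace ℝ (Fin d)) :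
    ∃ c : ℂ, ‖c‖ = 1 ∧ ∀ f, latShift p (tfShift a b f) = c • tfShift a b (latShift p f) :=
  ⟨_, norm_exp_two_pi_mul _, fun f => tfShift_comm a b _ _ f⟩

end TimeFrequency

/-! ### The dual window -/

section Dual

variable {d : ℕ}

/-- `γ` is the dual window of a Gabor Riesz basis generated by `g`, with bounds `A` and `K`. -/
structure IsDualWindow (g γ : L2 d) (A K : ℝ) : Prop where
  pos : 0 < A
  inner_self : ⟪g, γ⟫_ℂ = 1
  inner_ne : ∀ p, p ≠ 0 → ⟪latShift p g, γ⟫_ℂ = 0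
  lower : ∀ f, A * ‖f‖ ^ 2 ≤ ∑' p, ‖⟪latShift p g, f⟫_ℂ‖ ^ 2
  upper : ∀ f, ∑' p, ‖⟪latShift p γ, f⟫_ℂ‖ ^ 2 ≤ K * ‖f‖ ^ 2
  expansion : ∀ f h, HasSum (fun p => ⟪f, latShift p γ⟫_ℂ * ⟪latShift p g, h⟫_ℂ) ⟪f, h⟫_ℂ

/-- The window is `R g`, with `R` the inverse frame operator. The dual family is its Gabor system
because `latShift p (R g)` and `R (latShift p g)` have the same, biorthogonal, inner products with
the complete system `latShift q g`. -/
theorem IsExactFrame.exists_dualWindow {g : L2 d} (hg : IsExactFrame (gaborSystem g)) :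
    ∃ γ A K, IsDualWindow g γ A K := by
  obtain ⟨R, hR, hRe⟩ := hg.1.exists_inverse_frameOperator
  have hbi := hg.inner_dual hR hRe
  obtain ⟨A, B, hA, hAB⟩ := hg.1
  simp only [gaborSystem_eq] at hR hRe hbi hAB
  have hzero : ∀ f, (∀ p, ⟪latShift p g, f⟫_ℂ = 0) → f = 0 := fun f hf => by
    have := (hAB f).2.1
    simp only [hf, norm_zero, ne_eq, OfNat.ofNat_ne_zero, not_false_eq_true, zero_pow,
      tsum_zero] at this
    have h2 : ‖f‖ ^ 2 = 0 := le_antisymm (nonpos_of_mul_nonpos_right this hA) (by positivity)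
    simpa using h2
  have h1 : ∀ p, ⟪latShift p g, R (latShift p g)⟫_ℂ = 1 := fun p => by
    rw [← hR]; exact (hbi p).1
  have hg1 : ⟪g, R g⟫_ℂ = 1 := by simpa only [latShift_zero] using h1 0
  have hgp : ∀ p, p ≠ 0 → ⟪latShift p g, R g⟫_ℂ = 0 := fun p hp => by
    simpa only [latShift_zero] using (hbi 0).2 p hp
  have hcomm : ∀ p, latShift p (R g) = R (latShift p g) := fun p => by
    refine sub_eq_zero.1 (hzero _ fun q => ?_)
    have h2 : ⟪latShift q g, latShift p (R g)⟫_ℂ = ⟪latShift (q - p) g, R g⟫_ℂ := by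
      rw [← neg_neg p, ← inner_latShift_left, latShift_latShift, neg_neg, sub_eq_add_neg]
    rw [inner_sub_right, h2]
    by_cases hqp : q = p
    · rw [hqp, sub_self, latShift_zero, hg1, h1, sub_self]
    · rw [hgp _ (sub_ne_zero.2 hqp), (hbi p).2 q hqp, sub_self]
  refine ⟨R g, A, B * ‖R‖ ^ 2, hA, hg1, hgp, fun f => (hAB f).2.1,
    fun f => ?_, fun f h => ?_⟩
  · simp only [hcomm, hR]
    rcases le_or_gt 0 B with hB | hB
    · calc _ ≤ B * ‖R f‖ ^ 2 := (hAB (R f)).2.2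
        _ ≤ B * (‖R‖ * ‖f‖) ^ 2 := by gcongr; exact R.le_opNorm f
        _ = _ := by ring
    -- The upper bound `B` has no prescribed sign; a negative one would force `g = 0`, against `⟪g,
    -- R g⟫ = 1`.
    · have h3 := ((hAB g).2.1).trans (hAB g).2.2
      have h4 : ‖g‖ ^ 2 ≤ 0 := by nlinarith [sq_nonneg ‖g‖]
      have h5 : g = 0 := by simpa using le_antisymm h4 (by positivity)
      simp [h5] at hg1
  · simp only [hcomm]
    simpa only [hR] using hRe f h

variable {g γ : L2 d} {A K : ℝ}

theorem IsDualWindow.inner_latShift_ne (hγ : IsDualWindow g γ A K)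
    {p : (Fin d → ℤ) × (Fin d → ℤ)} (hp : p ≠ 0) : ⟪g, latShift p γ⟫_ℂ = 0 := by
  rw [← neg_neg p, ← inner_latShift_left]
  exact hγ.inner_ne _ (neg_ne_zero.2 hp)

/-- The modulus of continuity of the dual window along a time-frequency shift is controlled by that
of the window. -/
theorem IsDualWindow.norm_tfShift_sub_le (hγ : IsDualWindow g γ A K)
    (a b : EuclideanSpace ℝ (Fin d)) :
    A * ‖tfShift a b γ - γ‖ ^ 2 ≤ K * ‖tfShift a b g - g‖ ^ 2 := by
  obtain ⟨x, hx⟩ := tfShift_surjective a b (tfShift a b γ - γ)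
  -- Shifting both windows preserves biorthogonality: the commutation phase only multiplies zeros.
  -- Hence the difference can be moved from `γ` to `g`.
  have key : ∀ p, ‖⟪latShift p g, x⟫_ℂ‖ = ‖⟪latShift (-p) γ, tfShift a b g - g⟫_ℂ‖ := fun p => by
    obtain ⟨c, hc, hcp⟩ := exists_latShift_tfShift p a b
    have h1 : ⟪latShift p (tfShift a b g), tfShift a b γ⟫_ℂ = ⟪latShift p g, γ⟫_ℂ := by
      by_cases hp : p = 0
      · rw [hp, latShift_zero, latShift_zero, LinearIsometry.inner_map_map]
      · rw [hcp, inner_smul_left, LinearIsometry.inner_map_map, hγ.inner_ne p hp, mul_zero]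
    have h2 : ‖⟪latShift p g, x⟫_ℂ‖ = ‖⟪latShift p (tfShift a b g), tfShift a b γ - γ⟫_ℂ‖ := by
      rw [hcp, inner_smul_left, ← hx, LinearIsometry.inner_map_map, norm_mul, RCLike.norm_conj, hc,
        one_mul]
    rw [h2, inner_sub_right, h1, ← inner_sub_left, ← map_sub, inner_latShift_left, norm_inner_symm,
      ← norm_neg, ← inner_neg_right, neg_sub]
  calc A * ‖tfShift a b γ - γ‖ ^ 2 = A * ‖x‖ ^ 2 := by rw [← hx, LinearIsometry.norm_map]
    _ ≤ ∑' p, ‖⟪latShift p g, x⟫_ℂ‖ ^ 2 := hγ.lower x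
    _ = ∑' p, ‖⟪latShift p γ, tfShift a b g - g⟫_ℂ‖ ^ 2 := by
      simp only [key]
      exact (Equiv.neg _).tsum_eq (fun p => ‖⟪latShift p γ, tfShift a b g - g⟫_ℂ‖ ^ 2)
    _ ≤ _ := hγ.upper _

end Dual

/-! ### Generators of modulations and translations -/

section Generators

open Filter Topology

variable {d : ℕ}

theorem tendsto_eLpNorm_zero_of_dominated {α ι : Type*} [MeasurableSpace α] {μ : Measure α}
    {l : Filter ι} [l.IsCountablyGenerated] {F : ι → α → ℂ} {G : α → ℂ} (hG : MemLp G 2 μ)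
    (hF : ∀ i, AEStronglyMeasurable (F i) μ) (hb : ∀ᶠ i in l, ∀ᵐ x ∂μ, ‖F i x‖ ≤ ‖G x‖)
    (hlim : ∀ᵐ x ∂μ, Tendsto (fun i => F i x) l (𝓝 0)) :
    Tendsto (fun i => eLpNorm (F i) 2 μ) l (𝓝 0) := by
  have h1 : Tendsto (fun i => ∫⁻ x, ‖F i x‖ₑ ^ (2 : ℝ) ∂μ) l (𝓝 (∫⁻ _, 0 ∂μ)) := by
    refine tendsto_lintegral_filter_of_dominated_convergence' (fun x => ‖G x‖ₑ ^ (2 : ℝ))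
      (Eventually.of_forall fun i => (hF i).enorm.pow_const _) ?_ ?_ ?_
    · filter_upwards [hb] with i hi
      filter_upwards [hi] with x hx
      gcongr
      exact enorm_le_iff_norm_le.2 hx
    · have := lintegral_rpow_enorm_lt_top_of_eLpNorm_lt_top (by norm_num) (by norm_num) hG.2
      simpa using this.ne
    · filter_upwards [hlim] with x hx
      have h2 := hx.enorm
      have h3 := ((ENNReal.continuous_rpow_const (y := (2 : ℝ))).tendsto _).comp h2
      simpa [Function.comp_def] using h3
  have h4 := ((ENNReal.continuous_rpow_const (y := (1 / 2 : ℝ))).tendsto _).comp h1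
  simp only [lintegral_zero] at h4
  rw [ENNReal.zero_rpow_of_pos (by norm_num)] at h4
  refine h4.congr fun i => ?_
  rw [eLpNorm_eq_lintegral_rpow_enorm_toReal (by norm_num) (by norm_num)]
  simp

theorem tendsto_slope_exp (u : ℝ) :
    Tendsto (fun t : ℝ => (t : ℂ)⁻¹ * (Complex.exp (2 * Real.pi * Complex.I * (t * u : ℝ)) - 1))
      (𝓝[≠] 0) (𝓝 (2 * Real.pi * Complex.I * u)) := by
  have h1 : HasDerivAt (fun t : ℝ => (2 * Real.pi * Complex.I * (t * u : ℝ) : ℂ))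
      (2 * Real.pi * Complex.I * (1 * u : ℝ)) 0 :=
    (((hasDerivAt_id (0 : ℝ)).mul_const u).ofReal_comp).const_mul _
  have h2 := h1.cexp
  simpa using h2.tendsto_slope_zero

theorem norm_slope_exp_le (t u : ℝ) :
    ‖(t : ℂ)⁻¹ * (Complex.exp (2 * Real.pi * Complex.I * (t * u : ℝ)) - 1)‖
      ≤ ‖(2 * Real.pi * Complex.I * u : ℂ)‖ := by
  have h1 := Real.norm_exp_I_mul_ofReal_sub_one_le (x := 2 * Real.pi * (t * u))
  rw [show (Complex.I * (2 * Real.pi * (t * u) : ℝ) : ℂ) = 2 * Real.pi * Complex.I * (t * u : ℝ) by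
    push_cast; ring] at h1
  rcases eq_or_ne t 0 with rfl | ht
  · simp
  rw [norm_mul, norm_inv, Complex.norm_real, inv_mul_le_iff₀ (norm_pos_iff.2 ht)]
  refine h1.trans (le_of_eq ?_)
  simp only [norm_mul, Complex.norm_I, Complex.norm_real, Complex.norm_ofNat, Real.norm_ofNat]
  ring

theorem coeFn_slope_tfShift (v : EuclideanSpace ℝ (Fin d)) (f : L2 d) (t : ℝ) :
    ((t : ℂ)⁻¹ • (tfShift 0 (t • v) f - f) : L2 d) =ᵐ[volume] fun x =>
      (t : ℂ)⁻¹ * (Complex.exp (2 * Real.pi * Complex.I * (t * ⟪v, x⟫_ℝ : ℝ)) - 1) * f x := by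
  filter_upwards [Lp.coeFn_smul (t : ℂ)⁻¹ (tfShift 0 (t • v) f - f),
    Lp.coeFn_sub (tfShift 0 (t • v) f) f, coeFn_tfShift 0 (t • v) f] with x h1 h2 h3
  rw [h1, Pi.smul_apply, h2, Pi.sub_apply, h3]
  simp only [timeFreqShiftFun, sub_zero, smul_eq_mul, real_inner_smul_left]
  ring

/-- On its domain, `2πi P_v` is the generator of the group of modulations along `v`. -/
theorem hasDerivAt_modulation (v : EuclideanSpace ℝ (Fin d)) (f : (opP v).domain) :
    HasDerivAt (fun t : ℝ => tfShift 0 (t • v) (f : L2 d))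
      ((2 * Real.pi * Complex.I : ℂ) • opP v f) 0 := by
  have hf : MemLp (mulDot v f) 2 volume := f.2
  have hP : opP v f =ᵐ[volume] mulDot v f := hf.coeFn_toLp
  rw [hasDerivAt_iff_tendsto_slope_zero, Lp.tendsto_Lp_iff_tendsto_eLpNorm']
  have hF : ∀ t : ℝ, (((t⁻¹ • (tfShift 0 ((0 + t) • v) (f : L2 d) - tfShift 0 ((0 : ℝ) • v) f)
      : L2 d) : EuclideanSpace ℝ (Fin d) → ℂ) -
      (((2 * Real.pi * Complex.I : ℂ) • opP v f : L2 d) : EuclideanSpace ℝ (Fin d) → ℂ))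
      =ᵐ[volume] fun x =>
      ((t : ℂ)⁻¹ * (Complex.exp (2 * Real.pi * Complex.I * (t * ⟪v, x⟫_ℝ : ℝ)) - 1)
        - 2 * Real.pi * Complex.I * ⟪v, x⟫_ℝ) * (f : L2 d) x := fun t => by
    have h0 : (t⁻¹ • (tfShift 0 ((0 + t) • v) (f : L2 d) - tfShift 0 ((0 : ℝ) • v) f) : L2 d)
        = (t : ℂ)⁻¹ • (tfShift 0 (t • v) (f : L2 d) - f) := by
      rw [zero_add, zero_smul, tfShift_zero, ← Complex.ofReal_inv]
      rfl
    rw [h0]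
    filter_upwards [coeFn_slope_tfShift v f t, hP,
      Lp.coeFn_smul (2 * Real.pi * Complex.I : ℂ) (opP v f)] with x h1 h2 h3
    rw [Pi.sub_apply, h1, h3, Pi.smul_apply, h2, mulDot, smul_eq_mul]
    ring
  -- In `4π`, one `2π` bounds the difference quotient and the other its limit.
  refine (tendsto_eLpNorm_zero_of_dominated (G := fun x => (4 * Real.pi : ℂ) * mulDot v f x)
    (hf.const_mul _) (fun t => ?_) (Eventually.of_forall fun t => Eventually.of_forall fun x => ?_)
    (Eventually.of_forall fun x => ?_)).congr fun t => (eLpNorm_congr_ae (hF t)).symm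
  · refine AEStronglyMeasurable.mul (Continuous.aestronglyMeasurable ?_) (Lp.aestronglyMeasurable _)
    fun_prop
  · rw [mulDot, ← mul_assoc, norm_mul, norm_mul]
    gcongr
    refine (norm_sub_le _ _).trans ((add_le_add_left (norm_slope_exp_le t _) _).trans (le_of_eq ?_))
    simp only [norm_mul, Complex.norm_I, Complex.norm_real, Complex.norm_ofNat]
    ring
  · simpa using ((tendsto_slope_exp ⟪v, x⟫_ℝ).sub_const
      (2 * Real.pi * Complex.I * ⟪v, x⟫_ℝ)).mul_const ((f : L2 d) x)

/-- Fatou: if `f` is Lipschitz along the modulations in direction `v`, it is in the domain of `P_v`. -/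
theorem mem_domain_opP_of_lipschitz (v : EuclideanSpace ℝ (Fin d)) (f : L2 d) (C : ℝ)
    (h : ∀ᶠ t : ℝ in 𝓝[≠] 0, ‖tfShift 0 (t • v) f - f‖ ≤ C * |t|) : f ∈ (opP v).domain := by
  have hs : Tendsto (fun n : ℕ => 1 / ((n : ℝ) + 1)) atTop (𝓝[≠] 0) :=
    tendsto_nhdsWithin_iff.2 ⟨tendsto_one_div_add_atTop_nhds_zero_nat,
      Eventually.of_forall fun n => by
        have : (0 : ℝ) < 1 / ((n : ℝ) + 1) := by positivity
        exact this.ne'⟩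
  set s : ℕ → ℝ := fun n => 1 / ((n : ℝ) + 1)
  set F : ℕ → L2 d := fun n => ((s n : ℂ)⁻¹ • (tfShift 0 (s n • v) f - f) : L2 d)
  have hlim : ∀ᵐ x, Tendsto (fun n => F n x) atTop
      (𝓝 ((2 * Real.pi * Complex.I) * mulDot v f x)) := by
    filter_upwards [ae_all_iff.2 fun n => coeFn_slope_tfShift v f (s n)] with x hx
    have := ((tendsto_slope_exp ⟪v, x⟫_ℝ).comp hs).mul_const (f x)
    rw [mulDot, ← mul_assoc]
    exact this.congr fun n => (hx n).symm
  have hle := Lp.eLpNorm_lim_le_liminf_eLpNorm (p := 2) (μ := volume) (f := fun n => F n)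
    (fun n => Lp.aestronglyMeasurable _) _ hlim
  have hbd : ∀ᶠ n in atTop, eLpNorm (F n) 2 volume ≤ ENNReal.ofReal C := by
    filter_upwards [hs.eventually h, hs.eventually self_mem_nhdsWithin] with n hn hn0
    rw [← Lp.enorm_def, ← ofReal_norm]
    refine ENNReal.ofReal_le_ofReal ?_
    rw [norm_smul, norm_inv, Complex.norm_real, inv_mul_le_iff₀ (norm_pos_iff.2 hn0)]
    rw [mul_comm]
    exact hn
  have hfin : eLpNorm (fun x => (2 * Real.pi * Complex.I) * mulDot v f x) 2 volume < ∞ :=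
    (hle.trans (liminf_le_of_frequently_le' hbd.frequently)).trans_lt ENNReal.ofReal_lt_top
  have hmeas : AEStronglyMeasurable (mulDot v f) volume := by
    refine AEStronglyMeasurable.mul (Continuous.aestronglyMeasurable ?_) (Lp.aestronglyMeasurable f)
    fun_prop
  have hm : MemLp (fun x => (2 * Real.pi * Complex.I) * mulDot v f x) 2 volume :=
    ⟨hmeas.const_mul _, hfin⟩
  have := hm.const_mul (2 * Real.pi * Complex.I : ℂ)⁻¹
  simp only [inv_mul_cancel_left₀ Complex.two_pi_I_ne_zero] at this
  exact this

/-- A change of variables in the Fourier integral of a Schwartz function, extended by density. The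
positive sign in the kernel gives the modulation by `+a`. -/
theorem fourierL2_translation (a : EuclideanSpace ℝ (Fin d)) (f : L2 d) :
    fourierL2 d (tfShift a 0 f) = tfShift 0 a (fourierL2 d f) := by
  refine DenseRange.induction_on
    (p := fun f : L2 d => fourierL2 d (tfShift a 0 f) = tfShift 0 a (fourierL2 d f))
    (SchwartzMap.denseRange_toLpCLM (E := EuclideanSpace ℝ (Fin d)) (F := ℂ) (p := 2) (μ := volume)
      ENNReal.ofNat_ne_top) f
    (isClosed_eq ((fourierL2 d).continuous.comp (tfShift a 0).continuous)
      ((tfShift 0 a).continuous.comp (fourierL2 d).continuous)) fun φ => ?_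
  have hF : ∀ ψ : SchwartzMap (EuclideanSpace ℝ (Fin d)) ℂ,
      fourierL2 d (ψ.toLp 2) = (𝓕⁻ ψ).toLp 2 := fun ψ => SchwartzMap.toLp_fourierInv_eq ψ
  have ht : tfShift a 0 (φ.toLp 2) = (φ.compSubConstCLM ℂ a).toLp 2 := by
    refine Lp.ext ?_
    filter_upwards [coeFn_tfShift a 0 (φ.toLp 2), timeFreqShiftFun_congr (φ.coeFn_toLp 2) a 0,
      (φ.compSubConstCLM ℂ a).coeFn_toLp 2] with x h1 h2 h3
    rw [h1, h2, h3]
    simp [timeFreqShiftFun]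
  rw [SchwartzMap.toLpCLM_apply]
  rw [ht, hF, hF]
  refine Lp.ext ?_
  filter_upwards [(𝓕⁻ (φ.compSubConstCLM ℂ a)).coeFn_toLp 2,
    coeFn_tfShift 0 a ((𝓕⁻ φ).toLp 2), timeFreqShiftFun_congr ((𝓕⁻ φ).coeFn_toLp 2) 0 a]
    with x h1 h2 h3
  rw [h1, h2, h3, timeFreqShiftFun, sub_zero, SchwartzMap.fourierInv_coe,
    SchwartzMap.fourierInv_coe, Real.fourierInv_eq', Real.fourierInv_eq',
    ← integral_sub_right_eq_self _ (-a), ← integral_const_mul]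
  congr 1
  ext y
  simp only [sub_neg_eq_add, SchwartzMap.compSubConstCLM_apply, add_sub_cancel_right, smul_eq_mul,
    ← mul_assoc, ← Complex.exp_add, inner_add_left]
  congr 2
  push_cast
  ring

theorem hasDerivAt_translation (w : EuclideanSpace ℝ (Fin d)) (f : (opM w).domain) :
    HasDerivAt (fun t : ℝ => tfShift (t • w) 0 (f : L2 d))
      ((2 * Real.pi * Complex.I : ℂ) • opM w f) 0 := by
  have h1 := hasDerivAt_modulation w ⟨fourierL2 d f, f.2⟩
  have h2 := (((fourierL2 d).symm.toContinuousLinearEquiv : L2 d →L[ℂ] L2 d).restrictScalars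
    ℝ).hasFDerivAt.comp_hasDerivAt 0 h1
  convert! h2 using 1
  · ext1 t
    exact (fourierL2 d).injective (by simp [fourierL2_translation])
  · exact ((fourierL2 d).symm.map_smul _ _).symm

theorem mem_domain_opM_of_lipschitz (w : EuclideanSpace ℝ (Fin d)) (f : L2 d) (C : ℝ)
    (h : ∀ᶠ t : ℝ in 𝓝[≠] 0, ‖tfShift (t • w) 0 f - f‖ ≤ C * |t|) : f ∈ (opM w).domain := by
  refine mem_domain_opP_of_lipschitz w (fourierL2 d f) C (h.mono fun t ht => ?_)
  rwa [← fourierL2_translation, ← map_sub, LinearIsometryEquiv.norm_map]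

end Generators

/-! ### Commutation relation against biorthogonality -/

section Commutation

open Filter Topology

variable {d : ℕ}

theorem inner_modulation_left (b : EuclideanSpace ℝ (Fin d)) (f h : L2 d) :
    ⟪tfShift 0 b f, h⟫_ℂ = ⟪f, tfShift 0 (-b) h⟫_ℂ := by
  rw [← (tfShift 0 (-b)).inner_map_map, tfShift_tfShift]
  simp [tfShift_zero]

theorem inner_translation_left (a : EuclideanSpace ℝ (Fin d)) (f h : L2 d) :
    ⟪tfShift a 0 f, h⟫_ℂ = ⟪f, tfShift (-a) 0 h⟫_ℂ := by
  rw [← (tfShift (-a) 0).inner_map_map, tfShift_tfShift]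
  simp [tfShift_zero]

/-- The second pair uses the adjoint shifts, so all mixed terms cancel and only the phase from
exchanging modulation and translation survives. -/
theorem inner_sub_sub_commutator (v w : EuclideanSpace ℝ (Fin d)) (f h : L2 d) :
    ⟪tfShift 0 v f - f, tfShift w 0 h - h⟫_ℂ
        - ⟪tfShift (-w) 0 f - f, tfShift 0 (-v) h - h⟫_ℂ
      = (1 - Complex.exp (2 * Real.pi * Complex.I * (⟪v, w⟫_ℝ : ℝ))) *
        ⟪tfShift 0 v f, tfShift w 0 h⟫_ℂ := by
  have h1 : ⟪tfShift (-w) 0 f, tfShift 0 (-v) h⟫_ℂ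
      = Complex.exp (2 * Real.pi * Complex.I * (⟪v, w⟫_ℝ : ℝ)) *
        ⟪tfShift 0 v f, tfShift w 0 h⟫_ℂ := by
    rw [← inner_modulation_left, tfShift_comm, inner_smul_left, inner_translation_left, neg_neg,
      ← Complex.exp_conj]
    congr 2
    simp [inner_neg_right, Complex.conj_ofNat]
  have h2 : ⟪tfShift (-w) 0 f, h⟫_ℂ = ⟪f, tfShift w 0 h⟫_ℂ := by
    rw [inner_translation_left, neg_neg]
  simp only [inner_sub_left, inner_sub_right]
  rw [h1, h2, inner_modulation_left v f h]
  ring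

/-- The canonical commutation relation in weak form. -/
theorem inner_deriv_commutator {v w : EuclideanSpace ℝ (Fin d)} {f h fE fT hE hT : L2 d}
    (hfE : HasDerivAt (fun t : ℝ => tfShift 0 (t • v) f) fE 0)
    (hfT : HasDerivAt (fun t : ℝ => tfShift (t • w) 0 f) fT 0)
    (hhE : HasDerivAt (fun t : ℝ => tfShift 0 (t • v) h) hE 0)
    (hhT : HasDerivAt (fun t : ℝ => tfShift (t • w) 0 h) hT 0) :
    ⟪fE, hT⟫_ℂ - ⟪fT, hE⟫_ℂ = -(2 * Real.pi * Complex.I * ⟪v, w⟫_ℝ) * ⟪f, h⟫_ℂ := by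
  have hneg : Tendsto (fun t : ℝ => -t) (𝓝[≠] 0) (𝓝[≠] 0) := by
    refine tendsto_nhdsWithin_iff.2 ⟨?_, ?_⟩
    · exact (continuous_neg.tendsto' (0 : ℝ) 0 neg_zero).mono_left nhdsWithin_le_nhds
    · filter_upwards [self_mem_nhdsWithin] with t ht
      exact neg_ne_zero.2 ht
  -- The finite identity for `t • v`, `t • w` is divided by `t²`; its phase depends on `t² (v·w)`,
  -- so it becomes a difference quotient with increment `t²`.
  have hsq : Tendsto (fun t : ℝ => t ^ 2) (𝓝[≠] 0) (𝓝[≠] 0) := by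
    refine tendsto_nhdsWithin_iff.2 ⟨?_, ?_⟩
    · exact ((continuous_pow 2).tendsto' (0 : ℝ) 0 (by simp)).mono_left nhdsWithin_le_nhds
    · filter_upwards [self_mem_nhdsWithin] with t ht
      exact pow_ne_zero 2 ht
  have hL := (hfE.tendsto_slope_zero.inner (𝕜 := ℂ) hhT.tendsto_slope_zero).sub
    ((hfT.tendsto_slope_zero.comp hneg).inner (𝕜 := ℂ) (hhE.tendsto_slope_zero.comp hneg))
  have hR := ((tendsto_slope_exp ⟪v, w⟫_ℝ).comp hsq).neg.mul
    ((hfE.continuousAt.tendsto.inner (𝕜 := ℂ) hhT.continuousAt.tendsto).mono_left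
      (nhdsWithin_le_nhds (s := {0}ᶜ)))
  simp only [zero_smul, tfShift_zero] at hR
  refine tendsto_nhds_unique (hL.congr fun t => ?_) hR
  have h1 := inner_sub_sub_commutator (t • v) (t • w) f h
  simp only [Function.comp_apply, zero_add, zero_smul, tfShift_zero, neg_smul]
  have hsmul : ∀ (x : ℝ) (y : L2 d), x • y = (x : ℂ) • y := fun _ _ => rfl
  simp only [hsmul, inner_smul_left, inner_smul_right, Complex.conj_ofReal]
  rw [real_inner_smul_left, real_inner_smul_right] at h1
  calc _ = (((t : ℂ) ^ 2)⁻¹) * (⟪tfShift 0 (t • v) f - f, tfShift (t • w) 0 h - h⟫_ℂ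
        - ⟪tfShift (-(t • w)) 0 f - f, tfShift 0 (-(t • v)) h - h⟫_ℂ) := by
        push_cast
        ring
    _ = _ := by
        rw [h1, ← mul_assoc t t, ← sq]
        push_cast
        ring

/-- Shifting both `f` and `h` by `t` leaves `⟪f, latShift p h⟫` constant: by isometry for `p = 0`,
and because it stays zero otherwise. The product rule at 0 then acts as an integration by parts. -/
theorem inner_deriv_latShift {a b : EuclideanSpace ℝ (Fin d)} {f h f' h' : L2 d}
    (hf : HasDerivAt (fun t : ℝ => tfShift (t • a) (t • b) f) f' 0)
    (hh : HasDerivAt (fun t : ℝ => tfShift (t • a) (t • b) h) h' 0)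
    (hfh : ∀ p, p ≠ 0 → ⟪f, latShift p h⟫_ℂ = 0) (p : (Fin d → ℤ) × (Fin d → ℤ)) :
    ⟪f', latShift p h⟫_ℂ = -⟪f, latShift p h'⟫_ℂ := by
  have h1 := hf.inner (𝕜 := ℂ) (((latShift p).toContinuousLinearMap.restrictScalars
    ℝ).hasFDerivAt.comp_hasDerivAt 0 hh)
  have h2 : (fun t : ℝ => ⟪tfShift (t • a) (t • b) f, ((latShift p).toContinuousLinearMap.restrictScalars
      ℝ ∘ fun t : ℝ => tfShift (t • a) (t • b) h) t⟫_ℂ) = fun _ => ⟪f, latShift p h⟫_ℂ := by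
    ext1 t
    change ⟪tfShift (t • a) (t • b) f, latShift p (tfShift (t • a) (t • b) h)⟫_ℂ = _
    by_cases hp : p = 0
    · rw [hp, latShift_zero, latShift_zero, LinearIsometry.inner_map_map]
    · obtain ⟨c, -, hc⟩ := exists_latShift_tfShift p (t • a) (t • b)
      rw [hc, inner_smul_right, LinearIsometry.inner_map_map, hfh p hp, mul_zero]
  rw [h2] at h1
  have h3 := h1.unique (hasDerivAt_const _ _)
  simp only [zero_smul, tfShift_zero] at h3
  change ⟪f, latShift p h'⟫_ℂ + ⟪f', latShift p (tfShift ((0 : ℝ) • a) ((0 : ℝ) • b) h)⟫_ℂ = 0 at h3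
  simp only [zero_smul, tfShift_zero] at h3
  exact eq_neg_of_add_eq_zero_right h3

variable {g γ : L2 d} {A K : ℝ}

theorem IsDualWindow.lipschitz (hγ : IsDualWindow g γ A K) {a b : EuclideanSpace ℝ (Fin d)}
    {g' : L2 d} (hg : HasDerivAt (fun t : ℝ => tfShift (t • a) (t • b) g) g' 0) :
    ∃ C, ∀ᶠ t : ℝ in 𝓝[≠] 0, ‖tfShift (t • a) (t • b) γ - γ‖ ≤ C * |t| := by
  obtain ⟨C, hC⟩ := hg.isBigO_sub.bound
  refine ⟨Real.sqrt (|K| / A) * |C|, (hC.filter_mono nhdsWithin_le_nhds).mono fun t ht => ?_⟩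
  simp only [zero_smul, tfShift_zero, sub_zero, Real.norm_eq_abs] at ht
  have h1 := hγ.norm_tfShift_sub_le (t • a) (t • b)
  have h2 : ‖tfShift (t • a) (t • b) g - g‖ ≤ |C| * |t| :=
    ht.trans (mul_le_mul_of_nonneg_right (le_abs_self C) (abs_nonneg t))
  have hA := hγ.pos
  refine (sq_le_sq₀ (norm_nonneg _) (by positivity)).1 ?_
  rw [mul_pow, mul_pow, Real.sq_sqrt (by positivity), div_mul_eq_mul_div, div_mul_eq_mul_div,
    le_div_iff₀ hA, mul_comm _ A, mul_assoc, ← mul_pow]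
  calc _ ≤ _ := h1
    _ ≤ |K| * ‖tfShift (t • a) (t • b) g - g‖ ^ 2 := by gcongr; exact le_abs_self K
    _ ≤ _ := by gcongr

/-- In each term of the expansion of `⟪gE, γT⟫` both derivatives change sides, the two signs cancel,
and the result is the term of `⟪gT, γE⟫` at `-p`. -/
theorem IsDualWindow.inner_deriv_comm (hγ : IsDualWindow g γ A K)
    {v w : EuclideanSpace ℝ (Fin d)} {gE gT γE γT : L2 d}
    (hgE : HasDerivAt (fun t : ℝ => tfShift 0 (t • v) g) gE 0)
    (hgT : HasDerivAt (fun t : ℝ => tfShift (t • w) 0 g) gT 0)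
    (hγE : HasDerivAt (fun t : ℝ => tfShift 0 (t • v) γ) γE 0)
    (hγT : HasDerivAt (fun t : ℝ => tfShift (t • w) 0 γ) γT 0) :
    ⟪gE, γT⟫_ℂ = ⟪gT, γE⟫_ℂ := by
  have hne : ∀ p, p ≠ 0 → ⟪g, latShift p γ⟫_ℂ = 0 := fun p hp => hγ.inner_latShift_ne hp
  have hE := inner_deriv_latShift (a := 0) (by simpa using hgE) (by simpa using hγE) hne
  have hT := inner_deriv_latShift (b := 0) (by simpa using hgT) (by simpa using hγT) hne
  have h1 := hγ.expansion gE γT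
  have h2 := (Equiv.neg _).hasSum_iff.2 (hγ.expansion gT γE)
  refine h1.unique (h2.congr_fun ?_)
  intro p
  simp only [Function.comp_apply, Equiv.neg_apply]
  rw [hE, hT, inner_latShift_left, inner_latShift_left, neg_neg]
  ring

/-- An exact Gabor frame generator is not in the domains of both `P_v` and `M_w`. -/
theorem IsExactFrame.not_mem_domains {v w : EuclideanSpace ℝ (Fin d)}
    (hg : IsExactFrame (gaborSystem g)) (hvw : ⟪v, w⟫_ℝ ≠ 0) (hP : g ∈ (opP v).domain) :
    g ∉ (opM w).domain := fun hM => by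
  obtain ⟨γ, A, K, hγ⟩ := hg.exists_dualWindow
  have hgE := hasDerivAt_modulation v ⟨g, hP⟩
  have hgT := hasDerivAt_translation w ⟨g, hM⟩
  obtain ⟨C, hC⟩ := hγ.lipschitz (a := 0) (b := v) (by simpa using hgE)
  obtain ⟨C', hC'⟩ := hγ.lipschitz (a := w) (b := 0) (by simpa using hgT)
  have hγE := hasDerivAt_modulation v
    ⟨γ, mem_domain_opP_of_lipschitz v γ C (by simpa using hC)⟩
  have hγT := hasDerivAt_translation w
    ⟨γ, mem_domain_opM_of_lipschitz w γ C' (by simpa using hC')⟩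
  have h1 := inner_deriv_commutator hgE hgT hγE hγT
  rw [hγ.inner_deriv_comm hgE hgT hγE hγT, sub_self, hγ.inner_self, mul_one, eq_comm, neg_eq_zero]
    at h1
  exact mul_ne_zero Complex.two_pi_I_ne_zero (Complex.ofReal_ne_zero.2 hvw) h1

/-- The factor `v·x` vanishes only on a hyperplane, a null set. This is needed because `0 * ∞ = 0`
in `ℝ≥0∞`: the finite factor of the product must not be zero. -/
theorem opP_injective {v : EuclideanSpace ℝ (Fin d)} (hv : v ≠ 0) (f : (opP v).domain)
    (hf : opP v f = 0) : (f : L2 d) = 0 := by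
  have hP : opP v f =ᵐ[volume] mulDot v f := MemLp.coeFn_toLp f.2
  have hnull : volume ((innerSL ℝ v).ker : Set (EuclideanSpace ℝ (Fin d))) = 0 := by
    refine Measure.addHaar_submodule _ _ fun h => hv ?_
    have : v ∈ (innerSL ℝ v).ker := h ▸ Submodule.mem_top
    simpa using this
  refine Lp.ext ?_
  filter_upwards [hP, Lp.coeFn_zero ℂ 2 (volume : Measure (EuclideanSpace ℝ (Fin d))),
    compl_mem_ae_iff.2 hnull] with x h1 h2 h3
  rw [hf, h2, Pi.zero_apply, mulDot, eq_comm, mul_eq_zero] at h1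
  rw [h2, Pi.zero_apply]
  refine h1.resolve_left fun h => h3 ?_
  simpa using h

theorem extNorm_opP_ne_zero {v : EuclideanSpace ℝ (Fin d)} (hv : v ≠ 0) {f : L2 d} (hf : f ≠ 0) :
    extNorm (opP v) f ≠ 0 := by
  rw [extNorm]
  split_ifs with h
  · exact fun h0 => hf (opP_injective hv ⟨f, h⟩ (enorm_eq_zero.1 h0))
  · exact ENNReal.top_ne_zero

theorem extNorm_opM_ne_zero {w : EuclideanSpace ℝ (Fin d)} (hw : w ≠ 0) {f : L2 d} (hf : f ≠ 0) :
    extNorm (opM w) f ≠ 0 := by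
  rw [extNorm]
  split_ifs with h
  · intro h0
    have h1 : (fourierL2 d).symm (opP w ⟨fourierL2 d f, h⟩) = 0 := enorm_eq_zero.1 h0
    have h2 := opP_injective hw ⟨fourierL2 d f, h⟩ (by simpa using h1)
    exact hf (by simpa using h2)
  · exact ENNReal.top_ne_zero

end Commutation
end BalianLow
end

theorem corollaryt2 (d : ℕ) (g : BalianLow.L2 d)
    (hg : BalianLow.IsExactFrame (BalianLow.gaborSystem g))
    (v w : EuclideanSpace ℝ (Fin d)) (hvw : ⟪v, w⟫_ℝ ≠ 0) :
    BalianLow.extNorm (BalianLow.opP v) g * BalianLow.extNorm (BalianLow.opM w) g = ∞ := by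
  have hv : v ≠ 0 := fun h => hvw (by rw [h, inner_zero_left])
  have hw : w ≠ 0 := fun h => hvw (by rw [h, inner_zero_right])
  have hg0 : g ≠ 0 := fun h => by
    obtain ⟨γ, A, K, hγ⟩ := hg.exists_dualWindow
    simpa [h] using hγ.inner_self
  by_cases hP : g ∈ (BalianLow.opP v).domain
  · have hM : BalianLow.extNorm (BalianLow.opM w) g = ∞ :=
      dif_neg (hg.not_mem_domains hvw hP)
    rw [hM, ENNReal.mul_top (BalianLow.extNorm_opP_ne_zero hv hg0)]
  · have hP' : BalianLow.extNorm (BalianLow.opP v) g = ∞ := dif_neg hP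
    rw [hP', ENNReal.top_mul (BalianLow.extNorm_opM_ne_zero hw hg0)]
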